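/- Let $n\ge 1$ and let $\Gamma$ be a Bieberbach group in dimension $n$, i.e. a discrete, cocompact group of isometries of the Euclidean space $E^n$ that acts without fixed points (no non-trivial element of $\Gamma$ fixes a point of $E^n$). Let $\Lambda\subset\Gamma$ be the normal subgroup of the translations in $\Gamma$, and suppose that the holonomy group $\Gamma/\Lambda$ of the flat manifold $E^n/\Gamma$ is cyclic of odd order. Then: 1. there is an isometry $\tau$ of $E^n/\Gamma$, induced by a translation of $E^n$, such that $\tau\circ\tau=\mathrm{id}$ and $\tau$ has no fixed point; 2. $E^n/\Gamma$ is the totally geodesic boundary of a compact flat manifold: there is a compact connected smooth $(n+1)$-dimensional Riemannian manifold $W$ with boundary, which is flat (locally isometric to the Euclidean space) and whose boundary is totally geodesic, such that $\partial W$ is isometric to $E^n/\Gamma$. -/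

import Mathlib

open scoped Manifold ContDiff
open Bundle

noncomputable section

/-- The Euclidean space `E^n`. -/
abbrev Euc (n : ℕ) : Type := EuclideanSpace ℝ (Fin n)

/-- The group of (affine) isometries of `E^n`. -/
abbrev IsomE (n : ℕ) : Type := Euc n ≃ᵃⁱ[ℝ] Euc n

/-- The tautological action of the isometry group on `E^n`. -/
instance isomAction (n : ℕ) : MulAction (IsomE n) (Euc n) where
  smul γ x := γ x
  one_smul _ := rfl
  mul_smul _ _ _ := rfl

/-- The translation `t_v` of vector `v`. -/
def transl {n : ℕ} (v : Euc n) : IsomE n := AffineIsometryEquiv.constVAdd ℝ (Euc n) v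

theorem transl_apply {n : ℕ} (v x : Euc n) : transl v x = v + x := rfl

/-- The quotient `E^n / Γ`, with the quotient topology. -/
abbrev EucQuot {n : ℕ} (Γ : Subgroup (IsomE n)) : Type :=
  MulAction.orbitRel.Quotient Γ (Euc n)

/-- The projection `E^n → E^n / Γ`. -/
def proj {n : ℕ} (Γ : Subgroup (IsomE n)) (x : Euc n) : EucQuot Γ :=
  Quotient.mk (MulAction.orbitRel Γ (Euc n)) x

theorem proj_eq_iff {n : ℕ} (Γ : Subgroup (IsomE n)) (x y : Euc n) :
    proj Γ x = proj Γ y ↔ ∃ γ ∈ Γ, γ y = x := by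
  unfold proj
  rw [Quotient.eq, MulAction.orbitRel_apply, MulAction.mem_orbit_iff]
  exact ⟨fun ⟨γ, h⟩ => ⟨γ.1, γ.2, h⟩, fun ⟨γ, hγ, h⟩ => ⟨⟨γ, hγ⟩, h⟩⟩

/-- A Bieberbach group: a discrete, cocompact group of isometries of `E^n` acting without
fixed points. -/
structure IsBieberbach {n : ℕ} (Γ : Subgroup (IsomE n)) : Prop where
  /-- `Γ` is discrete, for the topology of pointwise convergence (which on the isometry group
  of `E^n` is the same as the compact-open topology, i.e. its Lie group topology). -/
  discrete : DiscreteTopology ((fun γ : IsomE n => (γ : Euc n → Euc n)) '' (Γ : Set (IsomE n)))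
  /-- `Γ` is cocompact. -/
  cocompact : CompactSpace (EucQuot Γ)
  /-- `Γ` acts without fixed points. -/
  free : ∀ γ ∈ Γ, γ ≠ 1 → ∀ x : Euc n, γ x ≠ x

/-- The linear part of an isometry. -/
def linearPart (n : ℕ) : IsomE n →* (Euc n ≃ₗᵢ[ℝ] Euc n) where
  toFun γ := γ.linearIsometryEquiv
  map_one' := rfl
  map_mul' _ _ := rfl

/-- The normal subgroup `Λ` of the translations in `Γ`
(see `mem_translationSubgroup_iff`). -/
abbrev translationSubgroup {n : ℕ} (Γ : Subgroup (IsomE n)) : Subgroup Γ :=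
  ((linearPart n).comp Γ.subtype).ker

theorem mem_translationSubgroup_iff {n : ℕ} (Γ : Subgroup (IsomE n)) (γ : Γ) :
    γ ∈ translationSubgroup Γ ↔ ∃ v : Euc n, (γ : IsomE n) = transl v := by
  rw [MonoidHom.mem_ker]
  constructor
  · intro h
    refine ⟨γ.1 0, ?_⟩
    ext1 x
    have h1 : (γ : IsomE n).linearIsometryEquiv x = x := by
      have := congrArg (fun f : Euc n ≃ₗᵢ[ℝ] Euc n => f x) h
      exact this
    have h2 := (γ : IsomE n).map_vadd 0 x
    rw [h1] at h2
    simpa [transl_apply, add_comm] using h2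
  · rintro ⟨v, hv⟩
    change linearPart n (γ : IsomE n) = 1
    rw [hv]
    ext1 x
    have h2 := (transl v : IsomE n).map_vadd 0 x
    simp only [transl_apply, vadd_eq_add, add_zero] at h2
    change (transl v : IsomE n).linearIsometryEquiv x = x
    exact (add_right_cancel (h2.symm.trans (add_comm v x)))

/-- The holonomy group `Γ / Λ` of `E^n / Γ`. -/
abbrev HolonomyGroup {n : ℕ} (Γ : Subgroup (IsomE n)) : Type := Γ ⧸ translationSubgroup Γ

/-- The quotient distance on `E^n / Γ`. -/
def quotDist {n : ℕ} (Γ : Subgroup (IsomE n)) (p q : EucQuot Γ) : ℝ :=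
  sInf {d : ℝ | ∃ x y : Euc n, proj Γ x = p ∧ proj Γ y = q ∧ dist x y = d}

/-- `τ` is a translation of `E^n / Γ`: an isometry induced by a translation of `E^n`. -/
def IsQuotTranslation {n : ℕ} (Γ : Subgroup (IsomE n)) (τ : EucQuot Γ → EucQuot Γ) : Prop :=
  (∃ v : Euc n, ∀ x : Euc n, τ (proj Γ x) = proj Γ (transl v x)) ∧ Function.Bijective τ ∧
    ∀ p q : EucQuot Γ, quotDist Γ (τ p) (τ q) = quotDist Γ p q

section Riemannian

variable {m : ℕ} [NeZero m] {W : Type} [TopologicalSpace W]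
  [ChartedSpace (EuclideanHalfSpace m) W] [IsManifold (𝓡∂ m) ∞ W]

/-- Smooth Riemannian metrics on a smooth `m`-manifold with boundary. -/
abbrev SmoothMetric (m : ℕ) [NeZero m] (W : Type) [TopologicalSpace W]
    [ChartedSpace (EuclideanHalfSpace m) W] [IsManifold (𝓡∂ m) ∞ W] : Type :=
  ContMDiffRiemannianMetric (𝓡∂ m) ∞ (Euc m) (fun x : W => TangentSpace (𝓡∂ m) x)

/-- The metric is flat: every point (of the interior or of the boundary) has an open
neighbourhood that some smooth map sends isometrically, in the Riemannian sense, and injectively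
into the Euclidean space of the same dimension. -/
def IsFlat (g : SmoothMetric m W) : Prop :=
  ∀ p : W, ∃ U : Set W, IsOpen U ∧ p ∈ U ∧ ∃ φ : W → Euc m,
    ContMDiffOn (𝓡∂ m) (𝓡 m) ∞ φ U ∧ Set.InjOn φ U ∧
    ∀ q ∈ U, ∀ u v : TangentSpace (𝓡∂ m) q,
      inner ℝ (mfderiv (𝓡∂ m) (𝓡 m) φ q u : Euc m) (mfderiv (𝓡∂ m) (𝓡 m) φ q v : Euc m)
        = g.inner q u v

/-- The coefficients of the metric in the preferred (half-space) chart at `p`: the inner product,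
at the point of coordinates `y`, of the constant coordinate vector fields `a` and `b`. -/
def coordMetric (g : SmoothMetric m W) (p : W) (a b y : Euc m) : ℝ :=
  g.inner ((extChartAt (𝓡∂ m) p).symm y)
    (mfderivWithin (𝓡 m) (𝓡∂ m) (extChartAt (𝓡∂ m) p).symm (Set.range (𝓡∂ m)) y a)
    (mfderivWithin (𝓡 m) (𝓡∂ m) (extChartAt (𝓡∂ m) p).symm (Set.range (𝓡∂ m)) y b)

/-- The derivative of the metric coefficient `g(a, b)` at `p`, in the coordinate
direction `c`. -/
def coordMetricDeriv (g : SmoothMetric m W) (p : W) (c a b : Euc m) : ℝ :=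
  fderivWithin ℝ (coordMetric g p a b) (Set.range (𝓡∂ m)) (extChartAt (𝓡∂ m) p p) c

/-- The boundary is totally geodesic: its second fundamental form vanishes.
In a half-space chart at a boundary point the vectors tangent to the boundary are those whose
`0`-th coordinate is zero. For constant coordinate fields `u`, `v` tangent to the boundary and `ν`
normal to it, the Koszul formula gives
`2 g(∇_u v, ν) = D_u g(v, ν) + D_v g(u, ν) - D_ν g(u, v)`. -/
def HasTotallyGeodesicBoundary (g : SmoothMetric m W) : Prop :=
  ∀ p ∈ (𝓡∂ m).boundary W, ∀ u v ν : Euc m, u 0 = 0 → v 0 = 0 →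
    (∀ w : Euc m, w 0 = 0 → coordMetric g p ν w (extChartAt (𝓡∂ m) p p) = 0) →
    coordMetricDeriv g p u v ν + coordMetricDeriv g p v u ν - coordMetricDeriv g p ν u v = 0

/-- `ι` identifies the Riemannian manifold `E^n / Γ` with the boundary of `(W, g)`: it is a
bijection onto the boundary, and it is a smooth Riemannian isometric map, that is (as `E^n / Γ`
carries the structure that makes the projection a local isometry) its composition with the
projection from `E^n` is smooth and pulls the metric of `W` back to the Euclidean metric. -/
structure IsIsometryOntoBoundary {n : ℕ} (Γ : Subgroup (IsomE n)) (g : SmoothMetric m W)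
    (ι : EucQuot Γ → W) : Prop where
  injective : Function.Injective ι
  range_eq : Set.range ι = (𝓡∂ m).boundary W
  smooth : ContMDiff (𝓡 n) (𝓡∂ m) ∞ (fun x : Euc n => ι (proj Γ x))
  isometric : ∀ x u v : Euc n,
    g.inner (ι (proj Γ x))
      (mfderiv (𝓡 n) (𝓡∂ m) (fun x : Euc n => ι (proj Γ x)) x u)
      (mfderiv (𝓡 n) (𝓡∂ m) (fun x : Euc n => ι (proj Γ x)) x v) = inner ℝ u v

end Riemannian

/-- `E^n / Γ` is (isometric to) the totally geodesic boundary of a compact connected flat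
Riemannian manifold of dimension `n + 1`. -/
def IsGeodesicBoundaryOfCompactFlat {n : ℕ} (Γ : Subgroup (IsomE n)) : Prop :=
  ∃ (W : Type) (_ : TopologicalSpace W) (_ : ChartedSpace (EuclideanHalfSpace (n + 1)) W)
    (_ : IsManifold (𝓡∂ (n + 1)) ∞ W) (g : SmoothMetric (n + 1) W),
    T2Space W ∧ CompactSpace W ∧ ConnectedSpace W ∧
    IsFlat g ∧ HasTotallyGeodesicBoundary g ∧
    ∃ ι : EucQuot Γ → W, IsIsometryOntoBoundary Γ g ι

end

/-!
Let `γ ∈ Γ` be a lift of a generator of the holonomy and `r` the order of the holonomy. Then `γ ^ r`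
is a translation that commutes with all of `Γ`, and it is not trivial because `Γ` is torsion-free
(if `γ = 1`, then `Γ` is a lattice and every vector of it will do). So the lattice of `Γ` contains a
non-zero vector that the holonomy fixes, and dividing it by a power of `2` gives such a vector `l`
with `v = l / 2` not in the lattice. The translation `t_v` commutes with `Γ` and its square is in
`Γ`. If it agreed with `g ∈ Γ` at one point, then so would `t_v ^ 2` and `g ^ 2`, hence
`g ^ 2 = t_l`; as the holonomy has odd order, `g` would be a translation, so `g = t_v`, which is
excluded. Therefore `t_v` induces a free isometric involution `τ` of `E^n / Γ`
(`IsBieberbach.exists_half_translation`).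

The filling is the quotient of `E^n / Γ × [-1, 1]` by the free involution `(p, s) ↦ (τ p, -s)`,
obtained in one step as the quotient of the slab `E^n × [-1, 1]` by the group generated by `Γ` and
`(t_v, -1)` (`IsHalfTranslation.Filling`). Its boundary is the image of the face `s = -1`, which is
a copy of `E^n / Γ`. The group acts freely and properly discontinuously
(`IsBieberbach.finite_dist_le`), and it exchanges the faces `s = 1` and `s = -1`, so that the
complement of the face `s = 1` still maps onto the quotient. That complement is an open part of the
half-space, and the local inverses of the projection from it are charts whose transition maps are
restrictions of Euclidean isometries (`HalfSpaceUniformization`). In an atlas of this kind the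
standard scalar product defines a smooth metric with constant coefficients, which is flat and for
which the boundary is totally geodesic (`HasIsometricTransitions.metric`).
-/

open Filter Topology

noncomputable section

/-! ### Isometries of the Euclidean space -/

section Group

variable {n : ℕ}

theorem isom_mul_apply (g h : IsomE n) (x : Euc n) : (g * h) x = g (h x) := rfl

theorem isom_inv_apply_self (g : IsomE n) (x : Euc n) : g⁻¹ (g x) = x := g.symm_apply_apply x

theorem isom_apply_inv_self (g : IsomE n) (x : Euc n) : g (g⁻¹ x) = x := g.apply_symm_apply x

theorem isom_apply_add (g : IsomE n) (v x : Euc n) :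
    g (v + x) = g.linearIsometryEquiv v + g x := g.map_vadd x v

theorem transl_add (v w : Euc n) : transl (v + w) = transl v * transl w := by
  ext1 x
  simp [isom_mul_apply, transl_apply, add_assoc]

theorem transl_zero : transl (0 : Euc n) = 1 := by
  ext1 x
  simp [transl_apply]

theorem transl_injective : Function.Injective (transl (n := n)) := fun v w h => by
  have h2 := congrArg (fun g : IsomE n => g 0) h
  simpa [transl_apply] using h2

theorem mul_transl (g : IsomE n) (v : Euc n) :
    g * transl v = transl (g.linearIsometryEquiv v) * g := by
  ext1 x
  simp only [isom_mul_apply, transl_apply, isom_apply_add]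

/-- An isometry of finite order fixes the barycentre of each of its orbits. -/
theorem exists_fixedPoint_of_pow_eq_one (g : IsomE n) (k : ℕ) (hk : 0 < k) (h : g ^ k = 1) :
    ∃ x : Euc n, g x = x := by
  refine ⟨∑ i ∈ Finset.range k, (k : ℝ)⁻¹ • (g ^ i) 0, ?_⟩
  have hk' : (k : ℝ) ≠ 0 := by positivity
  have hlin : ∀ x : Euc n, g x = g.linearIsometryEquiv x + g 0 := fun x => by
    simpa using isom_apply_add g x 0
  have h1 : g 0 = ∑ i ∈ Finset.range k, (k : ℝ)⁻¹ • g 0 := by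
    rw [Finset.sum_const, Finset.card_range, ← Nat.cast_smul_eq_nsmul ℝ, smul_smul,
      mul_inv_cancel₀ hk', one_smul]
  have h2 : g (∑ i ∈ Finset.range k, (k : ℝ)⁻¹ • (g ^ i) 0)
      = ∑ i ∈ Finset.range k, (k : ℝ)⁻¹ • (g ^ (i + 1)) 0 := by
    rw [hlin, map_sum]
    conv_lhs => rw [h1]
    rw [← Finset.sum_add_distrib]
    refine Finset.sum_congr rfl fun i _ => ?_
    rw [map_smul, ← smul_add, ← hlin, pow_succ', isom_mul_apply]
  rw [h2, ← Finset.smul_sum, ← Finset.smul_sum]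
  congr 1
  have h3 := Finset.sum_range_succ (fun i => (g ^ i) (0 : Euc n)) k
  rw [Finset.sum_range_succ', h] at h3
  simpa using h3

end Group

/-! ### Bieberbach groups: discreteness, torsion-freeness and invariant lattice vectors -/

/-- The translation of vector `v` commutes with `Γ`, has its square in `Γ`, and agrees with no
element of `Γ` at any point: it induces an involution of `E^n / Γ` without fixed points. -/
structure IsHalfTranslation {n : ℕ} (Γ : Subgroup (IsomE n)) (v : Euc n) : Prop where
  comm : ∀ g ∈ Γ, Commute g (transl v)
  sq_mem : transl v * transl v ∈ Γ
  apply_ne : ∀ g ∈ Γ, ∀ x : Euc n, g x ≠ transl v x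

namespace IsBieberbach

variable {n : ℕ} {Γ : Subgroup (IsomE n)}

theorem eq_one_of_fixed (hΓ : IsBieberbach Γ) {g : IsomE n} (hg : g ∈ Γ) {x : Euc n}
    (h : g x = x) : g = 1 := by
  by_contra h1
  exact hΓ.free g hg h1 x h

theorem eq_of_apply_eq (hΓ : IsBieberbach Γ) {g h : IsomE n} (hg : g ∈ Γ) (hh : h ∈ Γ)
    {x : Euc n} (e : g x = h x) : g = h := by
  have : h⁻¹ * g = 1 := hΓ.eq_one_of_fixed (Γ.mul_mem (Γ.inv_mem hh) hg) (x := x) (by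
    rw [isom_mul_apply, e, isom_inv_apply_self])
  exact (inv_mul_eq_one.1 this).symm

/-- The identity is isolated in a Bieberbach group: an element that moves finitely many test
points by less than some `ε` is trivial. -/
theorem exists_isolating (hΓ : IsBieberbach Γ) : ∃ (F : Finset (Euc n)) (ε : ℝ), 0 < ε ∧
    ∀ g ∈ Γ, (∀ y ∈ F, dist (g y) y < ε) → g = 1 := by
  have hd := hΓ.discrete
  have ho := isOpen_discrete
    ({⟨_, 1, Γ.one_mem, rfl⟩} :
      Set ((fun γ : IsomE n => (γ : Euc n → Euc n)) '' (Γ : Set (IsomE n))))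
  obtain ⟨U, hU, hU1⟩ := isOpen_induced_iff.1 ho
  have h1 : ((1 : IsomE n) : Euc n → Euc n) ∈ U := by
    have : (⟨_, 1, Γ.one_mem, rfl⟩ :
        ((fun γ : IsomE n => (γ : Euc n → Euc n)) '' (Γ : Set (IsomE n)))) ∈ Subtype.val ⁻¹' U := by
      rw [hU1]; rfl
    exact this
  obtain ⟨F, u, hu, hF⟩ := isOpen_pi_iff.1 hU _ h1
  have h2 : ∀ᶠ ε in 𝓝[>] (0 : ℝ), ∀ y ∈ F, Metric.ball y ε ⊆ u y := by
    rw [Filter.eventually_all_finset]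
    intro y hy
    obtain ⟨δ, hδ, hb⟩ := Metric.isOpen_iff.1 (hu y hy).1 y (hu y hy).2
    filter_upwards [Ioo_mem_nhdsGT hδ] with ε hε
    exact (Metric.ball_subset_ball hε.2.le).trans hb
  obtain ⟨ε, hε, hpos⟩ := (h2.and self_mem_nhdsWithin).exists
  refine ⟨F, ε, hpos, fun g hg hgy => ?_⟩
  have h3 : (g : Euc n → Euc n) ∈ U := hF fun y hy => hε y hy (hgy y hy)
  have h4 : (⟨_, g, hg, rfl⟩ :
      ((fun γ : IsomE n => (γ : Euc n → Euc n)) '' (Γ : Set (IsomE n)))) ∈ Subtype.val ⁻¹' U := h3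
  rw [hU1] at h4
  exact DFunLike.coe_injective (congrArg Subtype.val h4)

/-- A Bieberbach group acts properly discontinuously. The values at the test points of
`exists_isolating` separate the elements of the group by a fixed distance, and those of the
elements below stay in a compact set. -/
theorem finite_dist_le (hΓ : IsBieberbach Γ) (a b : Euc n) (R : ℝ) :
    {g : IsomE n | g ∈ Γ ∧ dist (g a) b ≤ R}.Finite := by
  obtain ⟨F, ε, hε, hF⟩ := hΓ.exists_isolating
  let Φ : IsomE n → F → Euc n := fun g y => g y
  obtain ⟨D, hD⟩ : ∃ D : ℝ, ∀ y ∈ F, dist y a ≤ D :=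
    ⟨∑ z ∈ F, dist z a, fun y hy =>
      Finset.single_le_sum (f := fun z => dist z a) (fun z _ => dist_nonneg) hy⟩
  obtain ⟨t, -, htf, ht⟩ :=
    (isCompact_closedBall (fun _ : F => b) (max 0 (D + R))).finite_cover_balls (half_pos hε)
  have hmem : ∀ g : IsomE n, g ∈ {g : IsomE n | g ∈ Γ ∧ dist (g a) b ≤ R} →
      ∃ c ∈ t, dist (Φ g) c < ε / 2 := by
    rintro g ⟨-, hg⟩
    have h1 : Φ g ∈ Metric.closedBall (fun _ : F => b) (max 0 (D + R)) := by
      rw [Metric.mem_closedBall, dist_pi_le_iff (le_max_left _ _)]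
      intro y
      calc dist (g y) b ≤ dist (g y) (g a) + dist (g a) b := dist_triangle _ _ _
        _ ≤ D + R := add_le_add (by rw [g.dist_map]; exact hD y y.2) hg
        _ ≤ _ := le_max_right _ _
    simpa using ht h1
  choose! c hct hc using hmem
  refine Set.Finite.of_injOn (f := c) hct (fun g hg h hh e => ?_) htf
  have hd : dist (Φ g) (Φ h) < ε := by
    have h1 := hc g hg
    have h2 := hc h hh
    rw [e] at h1
    calc dist (Φ g) (Φ h) ≤ dist (Φ g) (c h) + dist (Φ h) (c h) := dist_triangle_right _ _ _
      _ < ε / 2 + ε / 2 := add_lt_add h1 h2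
      _ = ε := add_halves ε
  have : h⁻¹ * g = 1 := by
    refine hF _ (Γ.mul_mem (Γ.inv_mem hh.1) hg.1) fun y hy => ?_
    rw [isom_mul_apply, ← (h : IsomE n).dist_map, isom_apply_inv_self]
    exact lt_of_le_of_lt (dist_le_pi_dist (Φ g) (Φ h) ⟨y, hy⟩) hd
  exact (inv_mul_eq_one.1 this).symm

/-- A Bieberbach group is torsion-free. -/
theorem eq_one_of_pow_eq_one (hΓ : IsBieberbach Γ) {g : IsomE n} (hg : g ∈ Γ) {k : ℕ}
    (hk : 0 < k) (h : g ^ k = 1) : g = 1 := by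
  obtain ⟨x, hx⟩ := exists_fixedPoint_of_pow_eq_one g k hk h
  exact hΓ.eq_one_of_fixed hg hx

/-- The lattice of a Bieberbach group has no infinitely `2`-divisible vectors. -/
theorem exists_half_notMem (hΓ : IsBieberbach Γ) {l : Euc n} (hl : transl l ∈ Γ) (h0 : l ≠ 0) :
    ∃ c : ℝ, transl (c • l) ∈ Γ ∧ transl ((c / 2) • l) ∉ Γ := by
  by_contra! H
  have h1 : ∀ k : ℕ, transl (((1 / 2 : ℝ) ^ k) • l) ∈ Γ := by
    intro k
    induction k with
    | zero => simpa using hl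
    | succ k ih => simpa [pow_succ, div_eq_mul_inv] using H _ ih
  obtain ⟨F, ε, hε, hF⟩ := hΓ.exists_isolating
  have hl0 : 0 < ‖l‖ := norm_pos_iff.2 h0
  obtain ⟨k, hk⟩ := exists_pow_lt_of_lt_one (div_pos hε hl0) (by norm_num : (1 / 2 : ℝ) < 1)
  have h2 := hF _ (h1 k) fun y _ => by
    rw [transl_apply, dist_eq_norm, add_sub_cancel_right, norm_smul,
      Real.norm_of_nonneg (by positivity)]
    exact (lt_div_iff₀ hl0).1 hk
  rw [← transl_zero] at h2
  have h3 := transl_injective h2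
  simp [h0] at h3

/-- In positive dimension a Bieberbach group is not trivial, as `E^n` is not compact. -/
theorem exists_ne_one (hn : 1 ≤ n) (hΓ : IsBieberbach Γ) : ∃ g ∈ Γ, g ≠ 1 := by
  by_contra! H
  have := hΓ.cocompact
  have hinj : Function.Injective (proj Γ) := fun x y h => by
    obtain ⟨g, hg, e⟩ := (proj_eq_iff Γ x y).1 h
    rw [H g hg] at e
    exact e.symm
  have hq : IsQuotientMap (proj Γ) := isQuotientMap_quotient_mk'
  let e : Euc n ≃ₜ EucQuot Γ := (Equiv.ofBijective _ ⟨hinj, hq.surjective⟩).toHomeomorph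
    (fun s => hq.isOpen_preimage)
  have : CompactSpace (Euc n) := e.symm.compactSpace
  have : Nonempty (Fin n) := ⟨⟨0, hn⟩⟩
  have : Nontrivial (Euc n) := inferInstance
  exact not_compactSpace_iff.2 (NormedSpace.noncompactSpace ℝ (Euc n)) inferInstance

/-- If the holonomy is cyclic and finite, then the lattice has a non-zero vector invariant under
the holonomy: a power of a lift of a generator. -/
theorem exists_invariant_ne_zero (hn : 1 ≤ n) (hΓ : IsBieberbach Γ)
    (hcyc : IsCyclic (HolonomyGroup Γ)) (hfin : 0 < Nat.card (HolonomyGroup Γ)) :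
    ∃ l : Euc n, l ≠ 0 ∧ transl l ∈ Γ ∧ ∀ g ∈ Γ, g.linearIsometryEquiv l = l := by
  obtain ⟨q, hq⟩ := hcyc.exists_generator
  obtain ⟨a, rfl⟩ := QuotientGroup.mk_surjective q
  set r := Nat.card (HolonomyGroup Γ)
  -- every element of `Γ` is a translation times a power of `a`
  have hgen : ∀ g ∈ Γ, ∃ (k : ℤ) (w : Euc n), g = (a : IsomE n) ^ k * transl w := by
    intro g hg
    obtain ⟨k, hk⟩ := hq (QuotientGroup.mk (⟨g, hg⟩ : Γ))
    have h1 : (a ^ k)⁻¹ * ⟨g, hg⟩ ∈ translationSubgroup Γ := by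
      rw [← QuotientGroup.eq]; exact hk
    obtain ⟨w, hw⟩ := (mem_translationSubgroup_iff Γ _).1 h1
    refine ⟨k, w, ?_⟩
    rw [← hw]
    simp
  have har : a ^ r ∈ translationSubgroup Γ := by
    rw [← QuotientGroup.eq_one_iff, QuotientGroup.mk_pow, pow_card_eq_one']
  obtain ⟨l, hl⟩ := (mem_translationSubgroup_iff Γ _).1 har
  rw [Subgroup.coe_pow] at hl
  have hlin : ∀ (g : IsomE n) (w : Euc n), g * transl w = transl w * g →
      g.linearIsometryEquiv w = w := fun g w h => by
    rw [mul_transl] at h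
    exact transl_injective (mul_right_cancel h)
  by_cases h0 : l = 0
  · -- then `a` has finite order, so it is trivial, and `Γ` consists of translations
    rw [h0, transl_zero] at hl
    have ha := hΓ.eq_one_of_pow_eq_one a.2 hfin hl
    have hgen' : ∀ g ∈ Γ, ∃ w : Euc n, g = transl w := fun g hg => by
      obtain ⟨k, w, hw⟩ := hgen g hg
      exact ⟨w, by rw [hw, ha]; simp⟩
    obtain ⟨g, hg, hg1⟩ := hΓ.exists_ne_one hn
    obtain ⟨w, rfl⟩ := hgen' g hg
    refine ⟨w, fun h => hg1 (by rw [h, transl_zero]), hg, fun h hh => hlin _ _ ?_⟩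
    obtain ⟨u, rfl⟩ := hgen' h hh
    rw [← transl_add, ← transl_add, add_comm]
  · refine ⟨l, h0, hl ▸ Γ.pow_mem a.2 r, fun g hg => hlin _ _ ?_⟩
    obtain ⟨k, w, rfl⟩ := hgen g hg
    have h1 : Commute ((a : IsomE n) ^ k) (transl l) := by
      rw [← hl]
      exact (Commute.refl _).zpow_left k |>.pow_right r
    have h2 : Commute (transl w) (transl l) := by
      rw [commute_iff_eq, ← transl_add, ← transl_add, add_comm]
    exact (h1.mul_left h2).eq

/-- The translation vector that induces the free involution: half of an invariant vector of the
lattice that is not twice a vector of the lattice. -/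
theorem exists_half_translation (hn : 1 ≤ n) (hΓ : IsBieberbach Γ)
    (hcyc : IsCyclic (HolonomyGroup Γ)) (hodd : Odd (Nat.card (HolonomyGroup Γ))) :
    ∃ v : Euc n, IsHalfTranslation Γ v := by
  obtain ⟨l, h0, hl, hinv⟩ := hΓ.exists_invariant_ne_zero hn hcyc hodd.pos
  obtain ⟨c, hc, hc2⟩ := hΓ.exists_half_notMem hl h0
  have hv2 : transl ((c / 2) • l) * transl ((c / 2) • l) = transl (c • l) := by
    rw [← transl_add, ← add_smul, add_halves]
  have hcomm : ∀ g ∈ Γ, Commute g (transl ((c / 2) • l)) := fun g hg => by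
    rw [commute_iff_eq, mul_transl, map_smul, hinv g hg]
  refine ⟨(c / 2) • l, hcomm, hv2 ▸ hc, fun g hg x hx => ?_⟩
  -- `g` agrees with the translation at `x`, hence so do their squares, which are both in `Γ`
  have hsq : g * g = transl (c • l) := by
    refine hΓ.eq_of_apply_eq (Γ.mul_mem hg hg) hc (x := x) ?_
    rw [isom_mul_apply, hx, ← isom_mul_apply, (hcomm g hg).eq, isom_mul_apply, hx,
      ← isom_mul_apply, hv2]
  -- a square root of a translation is a translation, as the holonomy has odd order
  have hq : (QuotientGroup.mk (⟨g, hg⟩ : Γ) : HolonomyGroup Γ) = 1 := by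
    have h1 : (QuotientGroup.mk (⟨g, hg⟩ : Γ) : HolonomyGroup Γ) ^ 2 = 1 := by
      rw [← QuotientGroup.mk_pow, QuotientGroup.eq_one_iff, mem_translationSubgroup_iff]
      exact ⟨c • l, by rw [Subgroup.coe_pow, pow_two]; exact hsq⟩
    have h2 := orderOf_dvd_of_pow_eq_one h1
    have h3 := orderOf_dvd_natCard (QuotientGroup.mk (⟨g, hg⟩ : Γ) : HolonomyGroup Γ)
    have h4 := Nat.dvd_gcd h2 h3
    rw [(Nat.coprime_two_left.2 hodd).gcd_eq_one, Nat.dvd_one] at h4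
    exact orderOf_eq_one_iff.1 h4
  rw [QuotientGroup.eq_one_iff, mem_translationSubgroup_iff] at hq
  obtain ⟨w, hw⟩ := hq
  change g = transl w at hw
  rw [hw, transl_apply, transl_apply] at hx
  rw [hw, add_right_cancel hx] at hg
  exact hc2 hg

end IsBieberbach

theorem IsHalfTranslation.exists_free_involution {n : ℕ} {Γ : Subgroup (IsomE n)} {v : Euc n}
    (h : IsHalfTranslation Γ v) :
    ∃ τ : EucQuot Γ → EucQuot Γ,
      IsQuotTranslation Γ τ ∧ Function.Involutive τ ∧ ∀ p : EucQuot Γ, τ p ≠ p := by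
  have hwd : ∀ x y : Euc n, proj Γ x = proj Γ y → proj Γ (transl v x) = proj Γ (transl v y) := by
    intro x y e
    obtain ⟨g, hg, rfl⟩ := (proj_eq_iff Γ x y).1 e
    refine (proj_eq_iff Γ _ _).2 ⟨g, hg, ?_⟩
    rw [← isom_mul_apply, (h.comm g hg).eq, isom_mul_apply]
  have hsurj : ∀ p : EucQuot Γ, ∃ x, proj Γ x = p := Quotient.exists_rep
  let τ : EucQuot Γ → EucQuot Γ :=
    Quotient.lift (fun x => proj Γ (transl v x)) fun x y e => hwd x y (Quotient.sound e)
  have hτ : ∀ x, τ (proj Γ x) = proj Γ (transl v x) := fun x => rfl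
  have hinv : Function.Involutive τ := fun p => by
    obtain ⟨x, rfl⟩ := hsurj p
    rw [hτ, hτ]
    exact (proj_eq_iff Γ _ _).2 ⟨_, h.sq_mem, rfl⟩
  -- both points can be moved by the translation without changing their distance
  have hle : ∀ (p q : EucQuot Γ) (d : ℝ),
      (∃ x y : Euc n, proj Γ x = p ∧ proj Γ y = q ∧ dist x y = d) →
      ∃ x y : Euc n, proj Γ x = τ p ∧ proj Γ y = τ q ∧ dist x y = d := by
    rintro p q d ⟨x, y, rfl, rfl, hd⟩
    exact ⟨transl v x, transl v y, rfl, rfl, by rw [(transl v).dist_map, hd]⟩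
  refine ⟨τ, ⟨⟨v, hτ⟩, hinv.bijective, fun p q => ?_⟩, hinv, fun p hp => ?_⟩
  · unfold quotDist
    congr 1
    ext d
    refine ⟨fun hd => ?_, hle p q d⟩
    have h2 := hle _ _ d hd
    rwa [hinv p, hinv q] at h2
  · obtain ⟨x, rfl⟩ := hsurj p
    obtain ⟨g, hg, e⟩ := (proj_eq_iff Γ _ _).1 hp
    exact h.apply_ne g hg x e

/-! ### Manifolds whose transition maps are isometries -/

section Isometry

variable {m : ℕ}

theorem isom_apply_eq (A : IsomE m) (x : Euc m) : A x = A.linearIsometryEquiv x + A 0 := by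
  simpa using isom_apply_add A x 0

theorem hasFDerivAt_isom (A : IsomE m) (x : Euc m) :
    HasFDerivAt A (A.linearIsometryEquiv.toContinuousLinearEquiv : Euc m →L[ℝ] Euc m) x := by
  have h : (A : Euc m → Euc m) = fun x => A.linearIsometryEquiv x + A 0 := funext (isom_apply_eq A)
  rw [h]
  exact (A.linearIsometryEquiv.toContinuousLinearEquiv : Euc m →L[ℝ] Euc m).hasFDerivAt.add_const _

theorem contDiff_isom (A : IsomE m) {k : WithTop ℕ∞} : ContDiff ℝ k A := by
  have h : (A : Euc m → Euc m) = fun x => A.linearIsometryEquiv x + A 0 := funext (isom_apply_eq A)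
  rw [h]
  exact A.linearIsometryEquiv.contDiff.add contDiff_const

end Isometry

section FlatStructure

variable {m : ℕ} [NeZero m] {W : Type} [TopologicalSpace W]
  [ChartedSpace (EuclideanHalfSpace m) W]

/-- The standard scalar product, as a continuous bilinear map. -/
def euclideanInner (m : ℕ) : Euc m →L[ℝ] Euc m →L[ℝ] ℝ := innerSL ℝ (E := Euc m)

/-- The standard scalar product on a tangent space, which Mathlib identifies with `ℝ^m` by means of
the preferred chart at its base point. -/
def tangentInner (p : W) :
    TangentSpace (𝓡∂ m) p →L[ℝ] TangentSpace (𝓡∂ m) p →L[ℝ] ℝ :=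
  euclideanInner m

/-- The transition maps between the preferred charts of `W` are locally restrictions of isometries
of the Euclidean space. -/
def HasIsometricTransitions (m : ℕ) [NeZero m] (W : Type) [TopologicalSpace W]
    [ChartedSpace (EuclideanHalfSpace m) W] : Prop :=
  ∀ p p' q : W, q ∈ (chartAt (EuclideanHalfSpace m) p).source →
    q ∈ (chartAt (EuclideanHalfSpace m) p').source →
    ∃ A : IsomE m, (extChartAt (𝓡∂ m) p' ∘ (extChartAt (𝓡∂ m) p).symm)
      =ᶠ[𝓝[Set.range (𝓡∂ m)] (extChartAt (𝓡∂ m) p q)] A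

variable [IsManifold (𝓡∂ m) ∞ W]

/-- The changes of coordinates of the tangent bundle are orthogonal. -/
theorem HasIsometricTransitions.inner_tangentCoordChange (hW : HasIsometricTransitions m W)
    {p p' q : W} (h : q ∈ (chartAt (EuclideanHalfSpace m) p).source)
    (h' : q ∈ (chartAt (EuclideanHalfSpace m) p').source) (u v : Euc m) :
    inner ℝ (tangentCoordChange (𝓡∂ m) p p' q u) (tangentCoordChange (𝓡∂ m) p p' q v)
      = inner ℝ u v := by
  obtain ⟨A, hA⟩ := hW p p' q h h'
  have hq : extChartAt (𝓡∂ m) p q ∈ Set.range (𝓡∂ m) := by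
    rw [extChartAt_coe]
    exact Set.mem_range_self _
  have h1 : HasFDerivWithinAt (extChartAt (𝓡∂ m) p' ∘ (extChartAt (𝓡∂ m) p).symm)
      (A.linearIsometryEquiv.toContinuousLinearEquiv : Euc m →L[ℝ] Euc m) (Set.range (𝓡∂ m))
      (extChartAt (𝓡∂ m) p q) :=
    (hasFDerivAt_isom A _).hasFDerivWithinAt.congr_of_eventuallyEq hA (hA.eq_of_nhdsWithin hq)
  rw [tangentCoordChange_def, h1.fderivWithin ((𝓡∂ m).uniqueDiffOn _ hq)]
  exact A.linearIsometryEquiv.inner_map_map u v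

/-- The standard scalar products form a smooth section: as the changes of coordinates are
orthogonal, the section is constant in every trivialization of the tangent bundle. -/
theorem HasIsometricTransitions.contMDiff_tangentInner (hW : HasIsometricTransitions m W) :
    ContMDiff (𝓡∂ m) ((𝓡∂ m).prod 𝓘(ℝ, Euc m →L[ℝ] Euc m →L[ℝ] ℝ)) ∞
      (fun p : W => TotalSpace.mk' (Euc m →L[ℝ] Euc m →L[ℝ] ℝ)
        (E := fun p : W => TangentSpace (𝓡∂ m) p →L[ℝ] TangentSpace (𝓡∂ m) p →L[ℝ] ℝ)
        p (tangentInner p)) := by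
  intro p
  rw [contMDiffAt_section]
  refine (contMDiffAt_const (c := euclideanInner m)).congr_of_eventuallyEq ?_
  filter_upwards [chart_source_mem_nhds (EuclideanHalfSpace m) p] with q hq
  have h1 : IsManifold (𝓡∂ m) 1 W := IsManifold.of_le (n := ∞) (by simp)
  ext u v
  have key := hW.inner_tangentCoordChange hq (mem_chart_source (EuclideanHalfSpace m) q) u v
  refine Eq.trans ?_ key
  have hq' : q ∈ (trivializationAt (Euc m) (TangentSpace (𝓡∂ m) : W → Type) p).baseSet := hq
  rw [hom_trivializationAt_apply, inCoordinates_apply_eq₂ hq' hq' (Set.mem_univ _)]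
  have hs : ∀ w : Euc m, (trivializationAt (Euc m) (TangentSpace (𝓡∂ m) : W → Type) p).symm q w
      = tangentCoordChange (𝓡∂ m) p q q w := fun w => by
    rw [← Trivialization.symmL_apply (R := ℝ) _ hq',
      TangentBundle.symmL_trivializationAt_eq_core hq]
    rfl
  rw [hs, hs, Trivialization.coe_linearMapAt_of_mem _ (Set.mem_univ _)]
  rfl

/-- The flat metric of a manifold whose transition maps are isometric. -/
def HasIsometricTransitions.metric (hW : HasIsometricTransitions m W) : SmoothMetric m W where
  inner := tangentInner
  symm _ v w := real_inner_comm (F := Euc m) w v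
  pos _ v hv := real_inner_self_pos (F := Euc m) (x := v) |>.2 hv
  isVonNBounded _ := by
    change Bornology.IsVonNBounded ℝ {v : Euc m | inner ℝ v v < 1}
    have : Metric.ball (0 : Euc m) 1 = {v : Euc m | inner ℝ v v < 1} := by
      ext v
      rw [mem_ball_zero_iff, Set.mem_ofPred_eq, real_inner_self_eq_norm_sq,
        sq_lt_one_iff₀ (norm_nonneg v)]
    rw [← this]
    exact NormedSpace.isVonNBounded_ball ℝ (Euc m) 1
  contMDiff := hW.contMDiff_tangentInner

theorem HasIsometricTransitions.metric_inner (hW : HasIsometricTransitions m W) (p : W)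
    (u v : TangentSpace (𝓡∂ m) p) :
    hW.metric.inner p u v = inner ℝ (E := Euc m) u v := rfl

/-- The preferred charts are themselves isometries into the Euclidean space. -/
theorem HasIsometricTransitions.isFlat (hW : HasIsometricTransitions m W) : IsFlat hW.metric := by
  intro p
  refine ⟨(chartAt (EuclideanHalfSpace m) p).source, (chartAt _ p).open_source,
    mem_chart_source _ p, extChartAt (𝓡∂ m) p, contMDiffOn_extChartAt, ?_, fun q hq u v => ?_⟩
  · rw [← extChartAt_source (𝓡∂ m)]
    exact (extChartAt (𝓡∂ m) p).injOn
  · have h1 : IsManifold (𝓡∂ m) 1 W := IsManifold.of_le (n := ∞) (by simp)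
    rw [← TangentBundle.continuousLinearMapAt_trivializationAt hq,
      TangentBundle.continuousLinearMapAt_trivializationAt_eq_core hq]
    exact hW.inner_tangentCoordChange (mem_chart_source _ q) hq u v

theorem HasIsometricTransitions.coordMetric_eq (hW : HasIsometricTransitions m W) (p : W)
    (a b : Euc m) {y : Euc m} (hy : y ∈ (extChartAt (𝓡∂ m) p).target) :
    coordMetric hW.metric p a b y = inner ℝ a b := by
  have h1 : IsManifold (𝓡∂ m) 1 W := IsManifold.of_le (n := ∞) (by simp)
  obtain ⟨q, hq, rfl⟩ : ∃ q ∈ (chartAt (EuclideanHalfSpace m) p).source,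
      extChartAt (𝓡∂ m) p q = y := by
    refine ⟨(extChartAt (𝓡∂ m) p).symm y, ?_, (extChartAt (𝓡∂ m) p).right_inv hy⟩
    rw [← extChartAt_source (𝓡∂ m)]
    exact (extChartAt (𝓡∂ m) p).map_target hy
  have hl : (extChartAt (𝓡∂ m) p).symm (extChartAt (𝓡∂ m) p q) = q :=
    (extChartAt (𝓡∂ m) p).left_inv (by rwa [extChartAt_source])
  unfold coordMetric
  rw [hW.metric_inner, ← TangentBundle.symmL_trivializationAt hq,
    TangentBundle.symmL_trivializationAt_eq_core hq]
  exact hW.inner_tangentCoordChange hq (mem_chart_source _ q) a b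

theorem HasIsometricTransitions.coordMetricDeriv_eq_zero (hW : HasIsometricTransitions m W)
    (p : W) (c a b : Euc m) : coordMetricDeriv hW.metric p c a b = 0 := by
  have h1 : coordMetric hW.metric p a b
      =ᶠ[𝓝[Set.range (𝓡∂ m)] (extChartAt (𝓡∂ m) p p)] fun _ => inner ℝ a b := by
    filter_upwards [extChartAt_target_mem_nhdsWithin (I := 𝓡∂ m) p] with y hy
    exact hW.coordMetric_eq p a b hy
  unfold coordMetricDeriv
  rw [h1.fderivWithin_eq (hW.coordMetric_eq p a b (mem_extChartAt_target p)),
    fderivWithin_fun_const]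
  rfl

/-- Totally geodesic boundary: in the charts the metric coefficients are constant. -/
theorem HasIsometricTransitions.hasTotallyGeodesicBoundary (hW : HasIsometricTransitions m W) :
    HasTotallyGeodesicBoundary hW.metric := by
  intro p _ u v ν _ _ _
  simp only [hW.coordMetricDeriv_eq_zero, add_zero, sub_zero]

end FlatStructure

/-! ### Manifolds uniformized by an open part of the half-space -/

/-- A uniformization of `W` by an open subset `dom` of the half-space: a map from `dom` onto `W`
that is open, continuous and locally injective, and such that any two points with the same image
have neighbourhoods that correspond to each other under an isometry of the Euclidean space.
The map is defined on the whole half-space, but only its values on `dom` matter. -/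
class HalfSpaceUniformization (m : ℕ) [NeZero m] (W : Type) [TopologicalSpace W] where
  /-- The uniformizing map. -/
  toFun : EuclideanHalfSpace m → W
  /-- The open set on which the uniformizing map is considered. -/
  dom : Set (EuclideanHalfSpace m)
  isOpen_dom : IsOpen dom
  continuousOn : ContinuousOn toFun dom
  isOpen_image : ∀ V ⊆ dom, IsOpen V → IsOpen (toFun '' V)
  exists_rep : ∀ w, ∃ x ∈ dom, toFun x = w
  exists_injOn : ∀ x ∈ dom, ∃ V ⊆ dom, IsOpen V ∧ x ∈ V ∧ Set.InjOn toFun V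
  exists_isom : ∀ x ∈ dom, ∀ y ∈ dom, toFun x = toFun y → ∃ A : IsomE m, A x.1 = y.1 ∧
    ∀ᶠ z in 𝓝 x, ∃ z' ∈ dom, z'.1 = A z.1 ∧ toFun z' = toFun z
  boundary_of_eq : ∀ x ∈ dom, ∀ y ∈ dom, toFun x = toFun y → x.1 0 = 0 → y.1 0 = 0

namespace HalfSpaceUniformization

variable {m : ℕ} [NeZero m] {W : Type} [TopologicalSpace W] [D : HalfSpaceUniformization m W]

variable (m) in
/-- A chosen preimage of a point under the uniformizing map. -/
def rep (w : W) : EuclideanHalfSpace m := (D.exists_rep w).choose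

theorem rep_mem (w : W) : rep m w ∈ D.dom := (D.exists_rep w).choose_spec.1

theorem toFun_rep (w : W) : D.toFun (rep m w) = w := (D.exists_rep w).choose_spec.2

variable (m) in
/-- A chosen neighbourhood of `rep m w` on which the uniformizing map is injective. -/
def nhd (w : W) : Set (EuclideanHalfSpace m) := (D.exists_injOn _ (rep_mem w)).choose

theorem nhd_subset (w : W) : nhd m w ⊆ D.dom := (D.exists_injOn _ (rep_mem w)).choose_spec.1

theorem isOpen_nhd (w : W) : IsOpen (nhd m w) := (D.exists_injOn _ (rep_mem w)).choose_spec.2.1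

theorem rep_mem_nhd (w : W) : rep m w ∈ nhd m w := (D.exists_injOn _ (rep_mem w)).choose_spec.2.2.1

theorem injOn_nhd (w : W) : Set.InjOn D.toFun (nhd m w) :=
  (D.exists_injOn _ (rep_mem w)).choose_spec.2.2.2

variable (m) in
/-- The chart at `w`: the inverse of the restriction of the uniformizing map to `nhd m w`. -/
def chart (w : W) : OpenPartialHomeomorph W (EuclideanHalfSpace m) :=
  (OpenPartialHomeomorph.ofContinuousOpenRestrict
    ((injOn_nhd w).toPartialEquiv D.toFun (nhd m w)) (D.continuousOn.mono (nhd_subset w))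
    (fun s hs => by
      have h : (nhd m w).domRestrict D.toFun '' s = D.toFun '' (Subtype.val '' s) := by
        rw [← Set.image_comp]; rfl
      exact h ▸ D.isOpen_image _ ((Subtype.coe_image_subset _ _).trans (nhd_subset w))
        ((isOpen_nhd w).isOpenMap_subtype_val s hs))
    (isOpen_nhd w)).symm

theorem chart_toFun (w : W) {y : EuclideanHalfSpace m} (hy : y ∈ nhd m w) :
    chart m w (D.toFun y) = y :=
  (chart m w).right_inv hy

theorem mem_chart_source (w : W) : w ∈ (chart m w).source :=
  ⟨rep m w, rep_mem_nhd w, toFun_rep w⟩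

theorem chart_self (w : W) : chart m w w = rep m w := by
  conv_lhs => rw [← toFun_rep (m := m) w]
  rw [toFun_rep, ← chart_toFun w (rep_mem_nhd w), toFun_rep]

/-- Read in a chart, the uniformizing map is locally an isometry. -/
theorem exists_chart_toFun_eq (w : W) {x : EuclideanHalfSpace m} (hx : x ∈ D.dom)
    (hw : D.toFun x ∈ (chart m w).source) :
    ∃ A : IsomE m, ∀ᶠ z in 𝓝 x, (chart m w (D.toFun z)).1 = A z.1 := by
  obtain ⟨y, hy, hyx⟩ := hw
  obtain ⟨A, hA, hloc⟩ := D.exists_isom x hx y (nhd_subset w hy) hyx.symm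
  obtain ⟨O, hO, hOn⟩ := isOpen_induced_iff.1 (isOpen_nhd (m := m) w)
  have hyO : A x.1 ∈ O := by
    rw [hA]
    rw [← hOn] at hy
    exact hy
  have hc : ContinuousAt (fun z : EuclideanHalfSpace m => A z.1) x :=
    (A.continuous.comp continuous_subtype_val).continuousAt
  refine ⟨A, ?_⟩
  filter_upwards [hloc, hc.preimage_mem_nhds (hO.mem_nhds hyO)] with z ⟨z', _, hz', e⟩ hz
  have h1 : z' ∈ nhd m w := by
    rw [← hOn]
    change z'.1 ∈ O
    rw [hz']
    exact hz
  rw [← e, chart_toFun w h1, hz']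

instance : ChartedSpace (EuclideanHalfSpace m) W where
  atlas := Set.range (chart m)
  chartAt := chart m
  mem_chart_source := mem_chart_source
  chart_mem_atlas w := ⟨w, rfl⟩

/-- A property of germs at a point of the half-space, as a property of germs within the range of
the model. -/
theorem eventually_nhdsWithin_range {x : EuclideanHalfSpace m} {p : EuclideanHalfSpace m → Prop}
    (h : ∀ᶠ z in 𝓝 x, p z) :
    ∀ᶠ y in 𝓝[Set.range (𝓡∂ m)] ((𝓡∂ m) x), p ((𝓡∂ m).symm y) := by
  have h1 : Tendsto (𝓡∂ m).symm (𝓝[Set.range (𝓡∂ m)] ((𝓡∂ m) x)) (𝓝 x) := by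
    have := ((𝓡∂ m).continuous_symm.tendsto ((𝓡∂ m) x)).mono_left
      (nhdsWithin_le_nhds (s := Set.range (𝓡∂ m)))
    rwa [(𝓡∂ m).left_inv] at this
  exact h1.eventually h

/-- The transition maps between the charts are locally isometries. -/
theorem exists_transition_eq (w w' : W) {x : EuclideanHalfSpace m} (hx : x ∈ (chart m w).target)
    (hw : (chart m w).symm x ∈ (chart m w').source) :
    ∃ A : IsomE m, ((𝓡∂ m) ∘ chart m w' ∘ (chart m w).symm ∘ (𝓡∂ m).symm)
      =ᶠ[𝓝[Set.range (𝓡∂ m)] ((𝓡∂ m) x)] A := by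
  obtain ⟨A, hA⟩ := exists_chart_toFun_eq w' (nhd_subset w hx) hw
  refine ⟨A, ?_⟩
  filter_upwards [eventually_nhdsWithin_range hA, self_mem_nhdsWithin] with y hy hyr
  have h2 : ((𝓡∂ m).symm y).1 = y := (𝓡∂ m).right_inv hyr
  rw [h2] at hy
  exact hy

instance : IsManifold (𝓡∂ m) ∞ W := by
  refine isManifold_of_contDiffOn _ _ _ ?_
  rintro _ _ ⟨w, rfl⟩ ⟨w', rfl⟩ y ⟨hy, x, rfl⟩
  rw [Set.mem_preimage, (𝓡∂ m).left_inv] at hy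
  obtain ⟨A, hA⟩ := exists_transition_eq w w' hy.1 hy.2
  have h : ContDiffWithinAt ℝ ∞ ((𝓡∂ m) ∘ ((chart m w).symm ≫ₕ chart m w') ∘ (𝓡∂ m).symm)
      (Set.range (𝓡∂ m)) ((𝓡∂ m) x) :=
    (contDiff_isom A).contDiffWithinAt.congr_of_eventuallyEq hA
      (hA.eq_of_nhdsWithin (Set.mem_range_self _))
  exact h.mono Set.inter_subset_right

variable (m W) in
theorem hasIsometricTransitions : HasIsometricTransitions m W := by
  intro p p' q h h'
  have h1 : (chart m p).symm (chart m p q) = q := (chart m p).left_inv h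
  exact exists_transition_eq p p' ((chart m p).map_source h) (h1.symm ▸ h')

/-- The boundary of `W` is the image of the boundary of the half-space. -/
theorem toFun_mem_boundary_iff {x : EuclideanHalfSpace m} (hx : x ∈ D.dom) :
    D.toFun x ∈ (𝓡∂ m).boundary W ↔ x.1 0 = 0 := by
  have h1 : D.toFun x ∈ (𝓡∂ m).boundary W ↔ (rep m (D.toFun x)).1 0 = 0 := by
    change extChartAt (𝓡∂ m) (D.toFun x) (D.toFun x) ∈ frontier (Set.range (𝓡∂ m)) ↔ _
    rw [frontier_range_modelWithCornersEuclideanHalfSpace, ← chart_self]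
    exact eq_comm
  rw [h1]
  exact ⟨D.boundary_of_eq _ (rep_mem _) _ hx (toFun_rep _),
    D.boundary_of_eq _ hx _ (rep_mem _) (toFun_rep _).symm⟩

section Maps

variable {k : ℕ} {f : Euc k → EuclideanHalfSpace m}

theorem exists_extChartAt_comp_eq {x : Euc k} (hfc : ContinuousAt f x) (hf : f x ∈ D.dom) :
    ∃ A : IsomE m, (fun y => extChartAt (𝓡∂ m) (D.toFun (f x)) (D.toFun (f y)))
      =ᶠ[𝓝 x] fun y => A (f y).1 := by
  obtain ⟨A, hA⟩ := exists_chart_toFun_eq (D.toFun (f x)) hf (mem_chart_source _)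
  exact ⟨A, hfc.eventually hA⟩

theorem continuousAt_toFun_comp {x : Euc k} (hfc : ContinuousAt f x) (hf : f x ∈ D.dom) :
    ContinuousAt (fun y => D.toFun (f y)) x :=
  ContinuousAt.comp (g := D.toFun) (D.continuousOn.continuousAt (D.isOpen_dom.mem_nhds hf)) hfc

/-- A map into `W` that lifts to a smooth map into the half-space is smooth. -/
theorem contMDiffAt_toFun_comp {x : Euc k} (hfc : ContDiffAt ℝ ∞ (fun y => (f y).1) x)
    (hf : f x ∈ D.dom) : ContMDiffAt (𝓡 k) (𝓡∂ m) ∞ (fun y => D.toFun (f y)) x := by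
  have hc : ContinuousAt f x := Topology.IsInducing.subtypeVal.continuousAt_iff.2 hfc.continuousAt
  obtain ⟨A, hA⟩ := exists_extChartAt_comp_eq hc hf
  rw [contMDiffAt_iff]
  refine ⟨continuousAt_toFun_comp hc hf, ?_⟩
  refine ContDiffAt.contDiffWithinAt ?_
  exact ((contDiff_isom A).contDiffAt.comp x hfc).congr_of_eventuallyEq hA

/-- A map into `W` with an isometric lift to the half-space pulls the metric back to the Euclidean
one. -/
theorem metric_mfderiv_toFun_comp {x : Euc k} {L : Euc k →L[ℝ] Euc m}
    (hL : HasFDerivAt (fun y => (f y).1) L x) (hf : f x ∈ D.dom)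
    (hLi : ∀ u v, inner ℝ (L u) (L v) = inner ℝ u v) (u v : Euc k) :
    (hasIsometricTransitions m W).metric.inner (D.toFun (f x))
      (mfderiv (𝓡 k) (𝓡∂ m) (fun y => D.toFun (f y)) x u)
      (mfderiv (𝓡 k) (𝓡∂ m) (fun y => D.toFun (f y)) x v) = inner ℝ u v := by
  have hc : ContinuousAt f x := Topology.IsInducing.subtypeVal.continuousAt_iff.2 hL.continuousAt
  obtain ⟨A, hA⟩ := exists_extChartAt_comp_eq hc hf
  have h1 : HasMFDerivAt (𝓡 k) (𝓡∂ m) (fun y => D.toFun (f y)) x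
      ((A.linearIsometryEquiv.toContinuousLinearEquiv : Euc m →L[ℝ] Euc m).comp L) :=
    ⟨continuousAt_toFun_comp hc hf, (((hasFDerivAt_isom A _).comp x hL).congr_of_eventuallyEq
      hA).hasFDerivWithinAt⟩
  rw [h1.mfderiv, HasIsometricTransitions.metric_inner, ← hLi u v]
  exact A.linearIsometryEquiv.inner_map_map (L u) (L v)

end Maps

end HalfSpaceUniformization

/-! ### The slab and its quotient -/

section Slab

variable {n : ℕ}

/-- The slab `E^n × [-1, 1]`. -/
abbrev Slab (n : ℕ) : Type := Euc n × Set.Icc (-1 : ℝ) 1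

theorem units_cast_mul_self (ε : ℤˣ) : ((ε : ℤ) : ℝ) * ((ε : ℤ) : ℝ) = 1 := by
  exact_mod_cast Int.units_coe_mul_self ε

theorem units_cast_mul_mem_Icc (ε : ℤˣ) {s : ℝ} (hs : s ∈ Set.Icc (-1 : ℝ) 1) :
    ((ε : ℤ) : ℝ) * s ∈ Set.Icc (-1 : ℝ) 1 := by
  rw [Set.mem_Icc, ← abs_le] at hs ⊢
  rcases Int.units_eq_one_or ε with rfl | rfl <;> simpa using hs

theorem abs_units_cast_mul (ε : ℤˣ) (s : ℝ) : |((ε : ℤ) : ℝ) * s| = |s| := by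
  rcases Int.units_eq_one_or ε with rfl | rfl <;> simp

/-- The action of the isometries of `E^n` on the first factor of the slab, and of the signs on the
second one. -/
instance slabAction (n : ℕ) : MulAction (IsomE n × ℤˣ) (Slab n) where
  smul a q := (a.1 q.1, ⟨((a.2 : ℤ) : ℝ) * q.2, units_cast_mul_mem_Icc a.2 q.2.2⟩)
  one_smul q := by
    refine Prod.ext rfl (Subtype.ext ?_)
    change (((1 : ℤˣ) : ℤ) : ℝ) * (q.2 : ℝ) = q.2
    simp
  mul_smul a b q := by
    refine Prod.ext rfl (Subtype.ext ?_)
    change (((a.2 * b.2 : ℤˣ) : ℤ) : ℝ) * (q.2 : ℝ) = (a.2 : ℤ) * ((b.2 : ℤ) * q.2)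
    push_cast
    ring

/-- The restricted action, stated separately because the general instance search is slow to find it
on a product. -/
instance slabSubgroupAction (G : Subgroup (IsomE n × ℤˣ)) : MulAction G (Slab n) :=
  Subgroup.instMulAction

instance slabSubgroupSMul (G : Subgroup (IsomE n × ℤˣ)) : SMul G (Slab n) :=
  (slabSubgroupAction G).toSemigroupAction.toSMul

theorem slab_smul_fst (a : IsomE n × ℤˣ) (q : Slab n) : (a • q).1 = a.1 q.1 := rfl

theorem slab_smul_snd (a : IsomE n × ℤˣ) (q : Slab n) :
    ((a • q).2 : ℝ) = ((a.2 : ℤ) : ℝ) * q.2 := rfl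

theorem slab_dist_smul (a : IsomE n × ℤˣ) (p q : Slab n) : dist (a • p) (a • q) = dist p q := by
  rw [Prod.dist_eq, Prod.dist_eq, slab_smul_fst, slab_smul_fst, a.1.dist_map, Subtype.dist_eq,
    Subtype.dist_eq, slab_smul_snd, slab_smul_snd, Real.dist_eq, ← mul_sub, abs_units_cast_mul,
    Real.dist_eq]

theorem slab_continuous_smul (a : IsomE n × ℤˣ) : Continuous fun q : Slab n => a • q :=
  (Isometry.of_dist_eq (slab_dist_smul a)).continuous

/-- The point of `E^(n+1)` with `0`-th coordinate `t` and remaining coordinates `x`. -/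
def cons (t : ℝ) (x : Euc n) : Euc (n + 1) := WithLp.toLp 2 (Fin.cons t x.ofLp)

/-- The point of `E^n` obtained by forgetting the `0`-th coordinate. -/
def tail (y : Euc (n + 1)) : Euc n := WithLp.toLp 2 fun i => y i.succ

theorem cons_zero (t : ℝ) (x : Euc n) : cons t x 0 = t := rfl

theorem cons_tail (y : Euc (n + 1)) : cons (y 0) (tail y) = y := by
  ext i
  refine Fin.cases rfl (fun i => rfl) i

theorem continuous_cons : Continuous fun q : ℝ × Euc n => cons q.1 q.2 := by
  refine (PiLp.continuous_toLp 2 _).comp (continuous_pi fun i => ?_)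
  refine Fin.cases ?_ (fun i => ?_) i
  · exact continuous_fst
  · exact (EuclideanSpace.proj (𝕜 := ℝ) i).continuous.comp continuous_snd

theorem continuous_tail : Continuous (tail (n := n)) :=
  (PiLp.continuous_toLp 2 _).comp (continuous_pi fun i =>
    (EuclideanSpace.proj (𝕜 := ℝ) i.succ).continuous)

theorem dist_cons (t s : ℝ) (x y : Euc n) :
    dist (cons t x) (cons s y) = √(dist t s ^ 2 + dist x y ^ 2) := by
  rw [EuclideanSpace.dist_eq, EuclideanSpace.dist_eq x y, Fin.sum_univ_succ,
    Real.sq_sqrt (Finset.sum_nonneg fun i _ => sq_nonneg _)]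
  rfl

/-- The isometry of `E^(n+1)` induced by an isometry of `E^n` and a sign, the latter acting on the
`0`-th coordinate by a reflection in the hyperplane of equation `y 0 = 1`. -/
def slabIsom (a : IsomE n × ℤˣ) : IsomE (n + 1) :=
  IsometryEquiv.toRealAffineIsometryEquiv
    { toFun := fun y => cons (1 + ((a.2 : ℤ) : ℝ) * (y 0 - 1)) (a.1 (tail y))
      invFun := fun y => cons (1 + ((a.2 : ℤ) : ℝ) * (y 0 - 1)) (a.1⁻¹ (tail y))
      left_inv := fun y => by
        change cons (1 + ((a.2 : ℤ) : ℝ) *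
          (cons (1 + ((a.2 : ℤ) : ℝ) * (y 0 - 1)) (a.1 (tail y)) 0 - 1))
          (a.1⁻¹ (a.1 (tail y))) = y
        rw [cons_zero, isom_inv_apply_self, add_sub_cancel_left, ← mul_assoc,
          units_cast_mul_self, one_mul, add_sub_cancel, cons_tail]
      right_inv := fun y => by
        change cons (1 + ((a.2 : ℤ) : ℝ) *
          (cons (1 + ((a.2 : ℤ) : ℝ) * (y 0 - 1)) (a.1⁻¹ (tail y)) 0 - 1))
          (a.1 (a.1⁻¹ (tail y))) = y
        rw [cons_zero, isom_apply_inv_self, add_sub_cancel_left, ← mul_assoc,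
          units_cast_mul_self, one_mul, add_sub_cancel, cons_tail]
      isometry_toFun := Isometry.of_dist_eq fun y z => by
        rw [dist_cons, a.1.dist_map]
        conv_rhs => rw [← cons_tail y, ← cons_tail z, dist_cons]
        rw [Real.dist_eq, Real.dist_eq, add_sub_add_left_eq_sub, ← mul_sub, abs_units_cast_mul,
          sub_sub_sub_cancel_right] }

/-- The embedding of the slab in the half-space, by a translation of the last factor. -/
def slabToHalfSpace (q : Slab n) : EuclideanHalfSpace (n + 1) :=
  ⟨cons (q.2 + 1) q.1, by
    have := q.2.2.1
    rw [cons_zero]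
    linarith⟩

/-- The retraction of the half-space onto the slab. -/
def halfSpaceToSlab (y : EuclideanHalfSpace (n + 1)) : Slab n :=
  (tail y.1, Set.projIcc (-1) 1 (by norm_num) (y.1 0 - 1))

theorem continuous_slabToHalfSpace : Continuous (slabToHalfSpace (n := n)) :=
  Continuous.subtype_mk (continuous_cons.comp
    (((continuous_subtype_val.comp continuous_snd).add continuous_const).prodMk continuous_fst)) _

theorem continuous_halfSpaceToSlab : Continuous (halfSpaceToSlab (n := n)) :=
  (continuous_tail.comp continuous_subtype_val).prodMk (continuous_projIcc.comp
    (((EuclideanSpace.proj (𝕜 := ℝ) (0 : Fin (n + 1))).continuous.comp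
      continuous_subtype_val).sub continuous_const))

theorem halfSpaceToSlab_slabToHalfSpace (q : Slab n) :
    halfSpaceToSlab (slabToHalfSpace q) = q := by
  refine Prod.ext rfl ?_
  change Set.projIcc (-1 : ℝ) 1 (by norm_num) ((q.2 : ℝ) + 1 - 1) = q.2
  rw [add_sub_cancel_right, Set.projIcc_val]

theorem halfSpaceToSlab_snd {y : EuclideanHalfSpace (n + 1)} (hy : y.1 0 < 2) :
    ((halfSpaceToSlab y).2 : ℝ) = y.1 0 - 1 := by
  have h0 : 0 ≤ y.1 0 := y.2
  have h : y.1 0 - 1 ∈ Set.Icc (-1 : ℝ) 1 := ⟨by linarith, by linarith⟩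
  change ((Set.projIcc (-1 : ℝ) 1 (by norm_num) (y.1 0 - 1) : Set.Icc (-1 : ℝ) 1) : ℝ) = _
  rw [Set.projIcc_of_mem _ h]

theorem slabToHalfSpace_halfSpaceToSlab {y : EuclideanHalfSpace (n + 1)} (hy : y.1 0 < 2) :
    slabToHalfSpace (halfSpaceToSlab y) = y := by
  refine Subtype.ext ?_
  change cons (((halfSpaceToSlab y).2 : ℝ) + 1) (tail y.1) = y.1
  rw [halfSpaceToSlab_snd hy, sub_add_cancel, cons_tail]

theorem slabIsom_slabToHalfSpace (a : IsomE n × ℤˣ) (q : Slab n) :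
    slabIsom a (slabToHalfSpace q).1 = (slabToHalfSpace (a • q)).1 := by
  change cons (1 + ((a.2 : ℤ) : ℝ) * ((q.2 : ℝ) + 1 - 1)) (a.1 q.1)
    = cons (((a.2 : ℤ) : ℝ) * q.2 + 1) (a.1 q.1)
  rw [add_sub_cancel_right, add_comm (1 : ℝ)]

end Slab

namespace IsHalfTranslation

variable {n : ℕ} {Γ : Subgroup (IsomE n)} {v : Euc n}

/-- The group generated by `Γ`, acting trivially on the second factor of the slab, and by the
translation of vector `v` combined with the symmetry of the second factor. -/
def group (h : IsHalfTranslation Γ v) : Subgroup (IsomE n × ℤˣ) where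
  carrier := {a | ∃ g ∈ Γ, a = (g, 1) ∨ a = (g * transl v, -1)}
  one_mem' := ⟨1, Γ.one_mem, Or.inl rfl⟩
  mul_mem' := by
    rintro _ _ ⟨g, hg, rfl | rfl⟩ ⟨k, hk, rfl | rfl⟩
    · exact ⟨g * k, Γ.mul_mem hg hk, Or.inl rfl⟩
    · exact ⟨g * k, Γ.mul_mem hg hk, Or.inr (by simp [mul_assoc])⟩
    · refine ⟨g * k, Γ.mul_mem hg hk, Or.inr ?_⟩
      rw [Prod.mk_mul_mk, mul_one, mul_assoc, ← (h.comm k hk).eq, mul_assoc]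
    · refine ⟨g * k * (transl v * transl v), Γ.mul_mem (Γ.mul_mem hg hk) h.sq_mem, Or.inl ?_⟩
      rw [Prod.mk_mul_mk]
      congr 1
      calc g * transl v * (k * transl v) = g * (transl v * k) * transl v := by
            simp only [mul_assoc]
        _ = g * k * (transl v * transl v) := by rw [← (h.comm k hk).eq]; simp only [mul_assoc]
  inv_mem' := by
    rintro _ ⟨g, hg, rfl | rfl⟩
    · exact ⟨g⁻¹, Γ.inv_mem hg, Or.inl rfl⟩
    · refine ⟨g⁻¹ * (transl v * transl v)⁻¹, Γ.mul_mem (Γ.inv_mem hg) (Γ.inv_mem h.sq_mem),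
        Or.inr ?_⟩
      rw [Prod.inv_mk]
      congr 1
      rw [(h.comm g hg).eq]
      group

/-- The group acts freely on the first factor of the slab. -/
theorem eq_one_of_fixed (h : IsHalfTranslation Γ v) (hΓ : IsBieberbach Γ) {a : IsomE n × ℤˣ}
    (ha : a ∈ h.group) {x : Euc n} (hx : a.1 x = x) : a = 1 := by
  obtain ⟨g, hg, rfl | rfl⟩ := ha
  · rw [hΓ.eq_one_of_fixed hg hx]
    rfl
  · refine absurd ?_ (h.apply_ne g⁻¹ (Γ.inv_mem hg) x)
    conv_lhs => rw [← hx]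
    exact isom_inv_apply_self g _

theorem finite_dist_le (h : IsHalfTranslation Γ v) (hΓ : IsBieberbach Γ) (x y : Euc n) (R : ℝ) :
    {a : IsomE n × ℤˣ | a ∈ h.group ∧ dist (a.1 x) y ≤ R}.Finite := by
  refine (((hΓ.finite_dist_le x y R).image fun g => (g, (1 : ℤˣ))).union
    ((hΓ.finite_dist_le (transl v x) y R).image fun g => (g * transl v, (-1 : ℤˣ)))).subset ?_
  rintro _ ⟨⟨g, hg, rfl | rfl⟩, hd⟩
  · exact Or.inl ⟨g, ⟨hg, hd⟩, rfl⟩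
  · exact Or.inr ⟨g, ⟨hg, hd⟩, rfl⟩

end IsHalfTranslation

theorem exists_pos_le_of_finite {α : Type*} {S : Set α} {f : α → ℝ} (hf : ∀ a ∈ S, 0 < f a)
    (hfin : {a | a ∈ S ∧ f a ≤ 1}.Finite) : ∃ δ > 0, ∀ a ∈ S, δ ≤ f a := by
  rcases Set.eq_empty_or_nonempty {a | a ∈ S ∧ f a ≤ 1} with he | hne
  · refine ⟨1, one_pos, fun a ha => ?_⟩
    by_contra! hlt
    exact Set.notMem_empty a (he ▸ ⟨ha, hlt.le⟩)
  · obtain ⟨b, hb, hmin⟩ := Set.exists_min_image _ f hfin hne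
    refine ⟨f b, hf b hb.1, fun a ha => ?_⟩
    rcases le_total (f a) 1 with h1 | h1
    · exact hmin a ⟨ha, h1⟩
    · exact hb.2.trans h1

namespace IsHalfTranslation

variable {n : ℕ} {Γ : Subgroup (IsomE n)} {v : Euc n}

/-- The quotient of the slab by the group: the interval bundle over the quotient of `E^n / Γ` by
the involution that `v` induces. -/
abbrev Filling (h : IsHalfTranslation Γ v) : Type := MulAction.orbitRel.Quotient h.group (Slab n)

/-- The projection from the slab to its quotient. -/
def toFilling (h : IsHalfTranslation Γ v) (q : Slab n) : h.Filling :=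
  Quotient.mk (MulAction.orbitRel h.group (Slab n)) q

theorem toFilling_eq_iff (h : IsHalfTranslation Γ v) {p q : Slab n} :
    h.toFilling p = h.toFilling q ↔ ∃ a ∈ h.group, a • p = q := by
  unfold toFilling
  rw [eq_comm, Quotient.eq, MulAction.orbitRel_apply, MulAction.mem_orbit_iff]
  exact ⟨fun ⟨a, e⟩ => ⟨a.1, a.2, e⟩, fun ⟨a, ha, e⟩ => ⟨⟨a, ha⟩, e⟩⟩

theorem toFilling_smul (h : IsHalfTranslation Γ v) {a : IsomE n × ℤˣ} (ha : a ∈ h.group)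
    (q : Slab n) : h.toFilling (a • q) = h.toFilling q :=
  (h.toFilling_eq_iff.2 ⟨a, ha, rfl⟩).symm

theorem toFilling_surjective (h : IsHalfTranslation Γ v) : Function.Surjective h.toFilling :=
  Quotient.exists_rep

theorem continuous_toFilling (h : IsHalfTranslation Γ v) : Continuous h.toFilling :=
  continuous_quotient_mk'

theorem isOpenMap_toFilling (h : IsHalfTranslation Γ v) : IsOpenMap h.toFilling := by
  have : ContinuousConstSMul h.group (Slab n) := ⟨fun a => slab_continuous_smul a.1⟩
  exact isOpenMap_quotient_mk'_mul

/-- Proper discontinuity bounds below the distance between a point and an orbit that avoids it. -/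
theorem t2Space (h : IsHalfTranslation Γ v) (hΓ : IsBieberbach Γ) : T2Space h.Filling := by
  refine ⟨fun P Q hPQ => ?_⟩
  obtain ⟨p, rfl⟩ := h.toFilling_surjective P
  obtain ⟨q, rfl⟩ := h.toFilling_surjective Q
  obtain ⟨δ, hδ, hle⟩ := exists_pos_le_of_finite (S := (h.group : Set (IsomE n × ℤˣ)))
    (f := fun a => dist (a • p) q)
    (fun a ha => dist_pos.2 fun e => hPQ (h.toFilling_eq_iff.2 ⟨a, ha, e⟩))
    ((h.finite_dist_le hΓ p.1 q.1 1).subset fun a ha => ⟨ha.1, (le_max_left _ _).trans ha.2⟩)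
  refine ⟨h.toFilling '' Metric.ball p (δ / 2), h.toFilling '' Metric.ball q (δ / 2),
    h.isOpenMap_toFilling _ Metric.isOpen_ball, h.isOpenMap_toFilling _ Metric.isOpen_ball,
    ⟨p, Metric.mem_ball_self (half_pos hδ), rfl⟩, ⟨q, Metric.mem_ball_self (half_pos hδ), rfl⟩, ?_⟩
  rw [Set.disjoint_left]
  rintro _ ⟨p', hp', rfl⟩ ⟨q', hq', e⟩
  obtain ⟨a, ha, rfl⟩ := h.toFilling_eq_iff.1 e.symm
  have h1 : dist (a • p) q < δ := calc
    dist (a • p) q ≤ dist (a • p) (a • p') + dist (a • p') q := dist_triangle _ _ _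
    _ = dist p' p + dist (a • p') q := by rw [slab_dist_smul, dist_comm p]
    _ < δ / 2 + δ / 2 := add_lt_add hp' hq'
    _ = δ := add_halves δ
  exact absurd (hle a ha) (not_le.2 h1)

theorem connectedSpace (h : IsHalfTranslation Γ v) : ConnectedSpace h.Filling := by
  have h1 : ConnectedSpace (Set.Icc (-1 : ℝ) 1) :=
    isConnected_iff_connectedSpace.1 (isConnected_Icc (by norm_num))
  exact h.toFilling_surjective.connectedSpace h.continuous_toFilling

theorem toFilling_eq_of_proj_eq (h : IsHalfTranslation Γ v) {x y : Euc n} (e : proj Γ x = proj Γ y)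
    (s : Set.Icc (-1 : ℝ) 1) : h.toFilling (x, s) = h.toFilling (y, s) := by
  obtain ⟨g, hg, rfl⟩ := (proj_eq_iff Γ x y).1 e
  refine (h.toFilling_eq_iff.2 ⟨(g, 1), ⟨g, hg, Or.inl rfl⟩, ?_⟩).symm
  refine Prod.ext rfl (Subtype.ext ?_)
  rw [slab_smul_snd]
  simp

/-- The quotient of the slab is the image of the product of the compact space `E^n / Γ` with
`[-1, 1]`. -/
theorem compactSpace (h : IsHalfTranslation Γ v) (hΓ : IsBieberbach Γ) :
    CompactSpace h.Filling := by
  have hc := hΓ.cocompact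
  have h1 : ContinuousConstSMul Γ (Euc n) := ⟨fun g => g.1.continuous⟩
  have h2 : IsOpenQuotientMap (proj Γ) :=
    ⟨Quotient.exists_rep, continuous_quotient_mk', isOpenMap_quotient_mk'_mul⟩
  have h3 := (h2.prodMap (IsOpenQuotientMap.id (X := Set.Icc (-1 : ℝ) 1))).isQuotientMap
  let F : EucQuot Γ × Set.Icc (-1 : ℝ) 1 → h.Filling := fun p =>
    Quotient.lift (fun x => h.toFilling (x, p.2))
      (fun x y e => h.toFilling_eq_of_proj_eq (Quotient.sound e) p.2) p.1
  have hF : Continuous F := h3.continuous_iff.2 h.continuous_toFilling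
  have hs : Function.Surjective F := fun w => by
    obtain ⟨q, rfl⟩ := h.toFilling_surjective w
    exact ⟨(proj Γ q.1, q.2), rfl⟩
  exact hs.compactSpace hF

/-- The slab without the face `s = 1`, which the group exchanges with the face `s = -1`, is an
open part of the half-space that uniformizes the quotient of the slab. -/
abbrev uniformization (h : IsHalfTranslation Γ v) (hΓ : IsBieberbach Γ) :
    HalfSpaceUniformization (n + 1) h.Filling where
  toFun y := h.toFilling (halfSpaceToSlab y)
  dom := {y | y.1 0 < 2}
  isOpen_dom := isOpen_lt ((EuclideanSpace.proj (𝕜 := ℝ) (0 : Fin (n + 1))).continuous.comp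
    continuous_subtype_val) continuous_const
  continuousOn := (h.continuous_toFilling.comp continuous_halfSpaceToSlab).continuousOn
  isOpen_image V hV hVo := by
    have h1 : halfSpaceToSlab '' V = slabToHalfSpace ⁻¹' V := by
      ext q
      constructor
      · rintro ⟨y, hy, rfl⟩
        rw [Set.mem_preimage, slabToHalfSpace_halfSpaceToSlab (hV hy)]
        exact hy
      · exact fun hq => ⟨_, hq, halfSpaceToSlab_slabToHalfSpace q⟩
    rw [← Set.image_image, h1]
    exact h.isOpenMap_toFilling _ (hVo.preimage continuous_slabToHalfSpace)
  exists_rep w := by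
    obtain ⟨q, rfl⟩ := h.toFilling_surjective w
    have hq := q.2.2
    -- a point of the face `s = 1` is equivalent to a point of the face `s = -1`
    rcases hq.2.lt_or_eq with h1 | h1
    · refine ⟨slabToHalfSpace q, ?_, by rw [halfSpaceToSlab_slabToHalfSpace]⟩
      change (q.2 : ℝ) + 1 < 2
      linarith
    · have ha : (1 * transl v, -1) ∈ h.group := ⟨1, Γ.one_mem, Or.inr rfl⟩
      refine ⟨slabToHalfSpace ((1 * transl v, (-1 : ℤˣ)) • q), ?_, ?_⟩
      · change (((-1 : ℤˣ) : ℤ) : ℝ) * (q.2 : ℝ) + 1 < 2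
        rw [h1]
        norm_num
      · rw [halfSpaceToSlab_slabToHalfSpace, h.toFilling_smul ha]
  exists_injOn x hx := by
    obtain ⟨δ, hδ, hle⟩ := exists_pos_le_of_finite
      (S := {a : IsomE n × ℤˣ | a ∈ h.group ∧ a ≠ 1})
      (f := fun a => dist (a.1 (tail x.1)) (tail x.1))
      (fun a ha => dist_pos.2 fun e => ha.2 (h.eq_one_of_fixed hΓ ha.1 e))
      ((h.finite_dist_le hΓ _ _ 1).subset fun a ha => ⟨ha.1.1, ha.2⟩)
    have hc : Continuous fun y : EuclideanHalfSpace (n + 1) => tail y.1 :=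
      continuous_tail.comp continuous_subtype_val
    refine ⟨{y | y.1 0 < 2} ∩ (fun y => tail y.1) ⁻¹' Metric.ball (tail x.1) (δ / 2),
      Set.inter_subset_left, ?_, ⟨hx, Metric.mem_ball_self (half_pos hδ)⟩, ?_⟩
    · exact (isOpen_lt ((EuclideanSpace.proj (𝕜 := ℝ) (0 : Fin (n + 1))).continuous.comp
        continuous_subtype_val) continuous_const).inter (Metric.isOpen_ball.preimage hc)
    · rintro y ⟨hy, hyx⟩ z ⟨hz, hzx⟩ e
      obtain ⟨a, ha, e'⟩ := h.toFilling_eq_iff.1 e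
      have h1 : a.1 (tail y.1) = tail z.1 := congrArg Prod.fst e'
      have h2 : a = 1 := by
        by_contra hne
        refine absurd (hle a ⟨ha, hne⟩) (not_le.2 ?_)
        calc dist (a.1 (tail x.1)) (tail x.1)
            ≤ dist (a.1 (tail x.1)) (a.1 (tail y.1)) + dist (a.1 (tail y.1)) (tail x.1) :=
              dist_triangle _ _ _
          _ = dist (tail y.1) (tail x.1) + dist (tail z.1) (tail x.1) := by
              rw [a.1.dist_map, dist_comm, h1]
          _ < δ / 2 + δ / 2 := add_lt_add hyx hzx
          _ = δ := add_halves δ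
      rw [h2, one_smul] at e'
      rw [← slabToHalfSpace_halfSpaceToSlab hy, e', slabToHalfSpace_halfSpaceToSlab hz]
  exists_isom x hx y hy e := by
    obtain ⟨a, ha, e'⟩ := h.toFilling_eq_iff.1 e
    have hA : ∀ z : EuclideanHalfSpace (n + 1), z.1 0 < 2 →
        slabIsom a z.1 = (slabToHalfSpace (a • halfSpaceToSlab z)).1 := fun z hz => by
      rw [← slabIsom_slabToHalfSpace, slabToHalfSpace_halfSpaceToSlab hz]
    have hc0 : Continuous fun z : EuclideanHalfSpace (n + 1) => z.1 0 :=
      (EuclideanSpace.proj (𝕜 := ℝ) (0 : Fin (n + 1))).continuous.comp continuous_subtype_val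
    have hc : Continuous fun z : EuclideanHalfSpace (n + 1) =>
        slabToHalfSpace (a • halfSpaceToSlab z) :=
      continuous_slabToHalfSpace.comp ((slab_continuous_smul a).comp continuous_halfSpaceToSlab)
    have hxy : slabToHalfSpace (a • halfSpaceToSlab x) = y := by
      rw [e', slabToHalfSpace_halfSpaceToSlab hy]
    refine ⟨slabIsom a, by rw [hA x hx, hxy], ?_⟩
    have h1 : ∀ᶠ z in 𝓝 x, z.1 0 < 2 := hc0.continuousAt.eventually_lt continuousAt_const hx
    have h2 : ∀ᶠ z in 𝓝 x, (slabToHalfSpace (a • halfSpaceToSlab z)).1 0 < 2 :=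
      (hc0.comp hc).continuousAt.eventually_lt continuousAt_const
        (show (slabToHalfSpace (a • halfSpaceToSlab x)).1 0 < 2 from hxy ▸ hy)
    filter_upwards [h1, h2] with z hz hz'
    refine ⟨_, hz', (hA z hz).symm, ?_⟩
    rw [halfSpaceToSlab_slabToHalfSpace, h.toFilling_smul ha]
  boundary_of_eq x hx y hy e h0 := by
    obtain ⟨a, ha, e'⟩ := h.toFilling_eq_iff.1 e
    have h1 : ((a.2 : ℤ) : ℝ) * (halfSpaceToSlab x).2 = (halfSpaceToSlab y).2 := by
      rw [← slab_smul_snd, e']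
    rw [halfSpaceToSlab_snd hx, halfSpaceToSlab_snd hy, h0] at h1
    have hy' : y.1 0 < 2 := hy
    rcases Int.units_eq_one_or a.2 with h2 | h2
    · rw [h2] at h1
      norm_num at h1
      linarith
    · rw [h2] at h1
      norm_num at h1
      linarith

/-- The identification of `E^n / Γ` with the boundary. -/
def boundaryMap (h : IsHalfTranslation Γ v) : EucQuot Γ → h.Filling :=
  Quotient.lift (fun x => h.toFilling (x, ⟨-1, by norm_num⟩))
    fun _ _ e => h.toFilling_eq_of_proj_eq (Quotient.sound e) _

theorem boundaryMap_proj (h : IsHalfTranslation Γ v) (x : Euc n) :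
    h.boundaryMap (proj Γ x) = h.toFilling (x, ⟨-1, by norm_num⟩) := rfl

theorem boundaryMap_injective (h : IsHalfTranslation Γ v) : Function.Injective h.boundaryMap := by
  intro p q e
  obtain ⟨x, rfl⟩ : ∃ x, proj Γ x = p := Quotient.exists_rep p
  obtain ⟨y, rfl⟩ : ∃ y, proj Γ y = q := Quotient.exists_rep q
  obtain ⟨a, ⟨g, hg, rfl | rfl⟩, e'⟩ := h.toFilling_eq_iff.1 e
  · exact ((proj_eq_iff Γ y x).2 ⟨g, hg, congrArg Prod.fst e'⟩).symm
  · have h1 : (((-1 : ℤˣ) : ℤ) : ℝ) * (-1) = -1 := congrArg (fun q : Slab n => (q.2 : ℝ)) e'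
    norm_num at h1

end IsHalfTranslation

/-- The inclusion of `E^n` in the boundary of the half-space. -/
def boundaryInclusion {n : ℕ} (x : Euc n) : EuclideanHalfSpace (n + 1) :=
  ⟨cons 0 x, (cons_zero 0 x).ge⟩

/-- The inclusion of `E^n` in `E^(n+1)`, as a linear map. -/
def consZero (n : ℕ) : Euc n →L[ℝ] Euc (n + 1) :=
  LinearMap.toContinuousLinearMap
    { toFun := cons 0
      map_add' := fun x y => by
        ext i
        refine Fin.cases ?_ (fun i => rfl) i
        simp [cons_zero]
      map_smul' := fun c x => by
        ext i
        refine Fin.cases ?_ (fun i => rfl) i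
        simp [cons_zero] }

theorem consZero_apply {n : ℕ} (x : Euc n) : consZero n x = cons 0 x := rfl

theorem inner_consZero {n : ℕ} (x y : Euc n) :
    inner ℝ (consZero n x) (consZero n y) = inner ℝ x y := by
  rw [consZero_apply, consZero_apply, PiLp.inner_apply, PiLp.inner_apply, Fin.sum_univ_succ,
    cons_zero, inner_zero_left, zero_add]
  rfl

/-- The slab quotient is a flat filling of `E^n / Γ`. -/
theorem IsHalfTranslation.isGeodesicBoundaryOfCompactFlat {n : ℕ} {Γ : Subgroup (IsomE n)}
    {v : Euc n} (h : IsHalfTranslation Γ v) (hΓ : IsBieberbach Γ) :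
    IsGeodesicBoundaryOfCompactFlat Γ := by
  let D := h.uniformization hΓ
  have hmap : ∀ x : Euc n, h.boundaryMap (proj Γ x) = D.toFun (boundaryInclusion x) := fun x => by
    have h1 : slabToHalfSpace (x, ⟨-1, by norm_num⟩) = boundaryInclusion x := by
      refine Subtype.ext ?_
      change cons ((-1 : ℝ) + 1) x = cons 0 x
      rw [neg_add_cancel]
    rw [h.boundaryMap_proj, ← h1]
    change _ = h.toFilling (halfSpaceToSlab _)
    rw [halfSpaceToSlab_slabToHalfSpace]
  have hdom : ∀ x : Euc n, boundaryInclusion x ∈ D.dom := fun x => by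
    change (0 : ℝ) < 2
    norm_num
  refine ⟨h.Filling, inferInstance, inferInstance, inferInstance,
    (HalfSpaceUniformization.hasIsometricTransitions (n + 1) h.Filling).metric, h.t2Space hΓ,
    h.compactSpace hΓ, h.connectedSpace, HasIsometricTransitions.isFlat _,
    HasIsometricTransitions.hasTotallyGeodesicBoundary _, h.boundaryMap,
    h.boundaryMap_injective, ?_, ?_, ?_⟩
  · ext w
    obtain ⟨y, hy, rfl⟩ := D.exists_rep w
    rw [HalfSpaceUniformization.toFun_mem_boundary_iff hy]
    constructor
    · rintro ⟨p, hp⟩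
      obtain ⟨x, rfl⟩ : ∃ x, proj Γ x = p := Quotient.exists_rep p
      rw [hmap] at hp
      exact D.boundary_of_eq _ (hdom x) _ hy hp (cons_zero 0 x)
    · intro h0
      refine ⟨proj Γ (tail y.1), ?_⟩
      rw [hmap]
      congr 1
      refine Subtype.ext ?_
      have h1 := cons_tail y.1
      rwa [h0] at h1
  · rw [funext hmap]
    exact fun x => HalfSpaceUniformization.contMDiffAt_toFun_comp (consZero n).contDiff.contDiffAt
      (hdom x)
  · have key : ∀ f : Euc n → h.Filling, f = (fun x => D.toFun (boundaryInclusion x)) →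
        ∀ x u v : Euc n, (HalfSpaceUniformization.hasIsometricTransitions (n + 1)
          h.Filling).metric.inner (f x) (mfderiv (𝓡 n) (𝓡∂ (n + 1)) f x u)
          (mfderiv (𝓡 n) (𝓡∂ (n + 1)) f x v) = inner ℝ u v := by
      rintro _ rfl x u v
      exact HalfSpaceUniformization.metric_mfderiv_toFun_comp (consZero n).hasFDerivAt (hdom x)
        inner_consZero u v
    exact key _ (funext hmap)

end

theorem mainTheorem4 (n : ℕ) (hn : 1 ≤ n) (Γ : Subgroup (IsomE n)) (hΓ : IsBieberbach Γ)
    (hcyc : IsCyclic (HolonomyGroup Γ)) (hodd : Odd (Nat.card (HolonomyGroup Γ))) :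
    (∃ τ : EucQuot Γ → EucQuot Γ,
      IsQuotTranslation Γ τ ∧ Function.Involutive τ ∧ ∀ p : EucQuot Γ, τ p ≠ p) ∧
    IsGeodesicBoundaryOfCompactFlat Γ := by
  obtain ⟨v, hv⟩ := hΓ.exists_half_translation hn hcyc hodd
  exact ⟨hv.exists_free_involution, hv.isGeodesicBoundaryOfCompactFlat hΓ⟩
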